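/- All vector spaces are real and finite-dimensional; $V^*$ denotes the dual of $V$. Let $\mathsf{Cov}(V)$ be the commutative monoid (under pointwise addition) of positive semidefinite symmetric bilinear forms on $V^*$, and let $S(V) = V \times \mathsf{Cov}(V)$; an element $(\mu,\Sigma)$ of $S(V)$ is a Gaussian distribution $\mathcal N(\mu,\Sigma)$ on $V$. A linear map $f : V \to W$ acts by $S(f)(\mu,\Sigma) = (f\mu, f_*\Sigma)$, where $(f_*\Sigma)(g,h) = \Sigma(gf,hf)$. The category $\mathsf{GaussEx}$ of extended Gaussian maps has vector spaces as objects; a morphism $X \to Y$ is a triple $(D,f,s)$ of a subspace $D \subseteq Y$, a linear map $f : X \to Y/D$ and a Gaussian distribution $s \in S(Y/D)$. The composite of $(D,g,s) : X \to Y$ and $(E,f,t) : Y \to Z$ is $(F, \tilde f g, S(\tilde f)(s) + S(p)(t))$, where $F \subseteq Z$ is the preimage of $f[D] \subseteq Z/E$ (written $E + f[D]$), $p : Z/E \to Z/F$ is the projection and $\tilde f : Y/D \to Z/F$ is induced by $pf$. It is a Markov category: the tensor product on objects is $X \otimes Y = X \times Y$, the tensor product of $(D,f,s) : X \to Y$ and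 $(D',f',s') : X' \to Y'$ has subspace $D \times D'$, linear map $f \times f'$ and the product distribution of $s$ and $s'$ on $(Y/D)\times(Y'/D') \cong (Y\times Y')/(D\times D')$, and the copy and delete maps are the linear maps $x \mapsto (x,x)$ and $x \mapsto 0$. **Corollary 3.6.** The Markov category $\mathsf{GaussEx}$ has all conditionals: for all objects $A, X, Y$ and every morphism $\varphi : A \to X \otimes Y$ there is a morphism $\varphi_{|X} : X \otimes A \to Y$ such that $$\varphi = (\mathrm{id}_X \otimes \varphi_{|X}) \circ \big((\mathsf{cpy}_X \circ \varphi_X) \otimes \mathrm{id}_A\big) \circ \mathsf{cpy}_A ,$$ where $\varphi_X = (\mathrm{id}_X \otimes \mathsf{del}_Y) \circ \varphi : A \to X$ is the marginal, and coherence isomorphisms are suppressed. In particular, conditional distributions of extended Gaussians are again extended Gaussian: let $\psi$ be an extended Gaussian distribution on $X \times Y$, that is, a pair of a subspace $D \subseteq X \times Y$ and a Gaussian distribution on $(X \times Y)/D$, and let $\psi_X$ be its pushforward along the projection $X \times Y \to X$. Then there is an extended Gaussian map $k : X \to Y$ such that $\psi = (\mathrm{id}_X \otimes k) \circ \mathsf{cpy}_X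 \circ \psi_X$, where extended Gaussian distributions on $V$ are viewed as morphisms $0 \to V$. (The pushforward of $(D,\nu)$ along a linear map $h : V \to W$ is $(h[D], (h_D)_*\nu)$ with $h_D : V/D \to W/h[D]$ the induced map.) -/

import Mathlib

open CategoryTheory MonoidalCategory CopyDiscardCategory ComonObj

universe u

/-! ## Decoration functors -/

/-- A decoration functor: a functor from finite-dimensional real vector spaces to commutative
monoids. -/
abbrev DecorationFunctor : Type (u + 1) := FGModuleCat.{u} ℝ ⥤ AddCommMonCat.{u}

namespace DecorationFunctor

/-- The commutative monoid `S(V)` of decorations on `V`. -/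
abbrev Deco (S : DecorationFunctor.{u}) (V : Type u) [AddCommGroup V] [Module ℝ V]
    [Module.Finite ℝ V] : Type u :=
  S.obj (FGModuleCat.of ℝ V)

variable (S : DecorationFunctor.{u})
  {V W Z : Type u} [AddCommGroup V] [Module ℝ V] [Module.Finite ℝ V]
  [AddCommGroup W] [Module ℝ W] [Module.Finite ℝ W]
  [AddCommGroup Z] [Module ℝ Z] [Module.Finite ℝ Z]

/-- The action `S(f) : S(V) → S(W)` of a decoration functor on a linear map. -/
def push (f : V →ₗ[ℝ] W) : S.Deco V →+ S.Deco W :=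
  (S.map (FGModuleCat.ofHom f)).hom

theorem push_id (s : S.Deco V) : S.push LinearMap.id s = s := by
  have h : FGModuleCat.ofHom (LinearMap.id : V →ₗ[ℝ] V) = 𝟙 (FGModuleCat.of ℝ V) := rfl
  simp [push, h]

theorem push_push (g : W →ₗ[ℝ] Z) (f : V →ₗ[ℝ] W) (s : S.Deco V) :
    S.push g (S.push f s) = S.push (g ∘ₗ f) s := by
  have h : FGModuleCat.ofHom (g ∘ₗ f) = FGModuleCat.ofHom f ≫ FGModuleCat.ofHom g := rfl
  simp [push, h]

/-- The natural map `⊕ : S(V) × S(W) → S(V × W)`. -/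
def oplus (s : S.Deco V) (t : S.Deco W) : S.Deco (V × W) :=
  S.push (LinearMap.inl ℝ V W) s + S.push (LinearMap.inr ℝ V W) t

theorem push_oplus (h : V × W →ₗ[ℝ] Z) (s : S.Deco V) (t : S.Deco W) :
    S.push h (S.oplus s t) =
      S.push (h ∘ₗ LinearMap.inl ℝ V W) s + S.push (h ∘ₗ LinearMap.inr ℝ V W) t := by
  simp only [oplus, map_add, S.push_push]

theorem oplus_add (s s' : S.Deco V) (t t' : S.Deco W) :
    S.oplus (s + s') (t + t') = S.oplus s t + S.oplus s' t' := by
  simp only [oplus, map_add, add_add_add_comm]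

theorem oplus_zero : S.oplus (0 : S.Deco V) (0 : S.Deco W) = 0 := by
  simp [oplus]

theorem push_prodMap_oplus {V' W' : Type u} [AddCommGroup V'] [Module ℝ V'] [Module.Finite ℝ V']
    [AddCommGroup W'] [Module ℝ W'] [Module.Finite ℝ W']
    (f : V →ₗ[ℝ] V') (g : W →ₗ[ℝ] W') (s : S.Deco V) (t : S.Deco W) :
    S.push (f.prodMap g) (S.oplus s t) = S.oplus (S.push f s) (S.push g t) := by
  have h1 : f.prodMap g ∘ₗ LinearMap.inl ℝ V W = LinearMap.inl ℝ V' W' ∘ₗ f := by ext <;> simp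
  have h2 : f.prodMap g ∘ₗ LinearMap.inr ℝ V W = LinearMap.inr ℝ V' W' ∘ₗ g := by ext <;> simp
  rw [push_oplus, h1, h2, oplus, push_push, push_push]

theorem push_prodAssoc_oplus (s : S.Deco V) (t : S.Deco W) (r : S.Deco Z) :
    S.push (LinearEquiv.prodAssoc ℝ V W Z).toLinearMap (S.oplus (S.oplus s t) r) =
      S.oplus s (S.oplus t r) := by
  simp only [push_oplus]
  simp only [oplus, push_push, map_add, add_assoc]
  rfl

theorem push_prodComm_oplus (s : S.Deco V) (t : S.Deco W) :
    S.push (LinearEquiv.prodComm ℝ V W).toLinearMap (S.oplus s t) = S.oplus t s := by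
  simp only [push_oplus]
  rw [oplus, add_comm]
  rfl

theorem push_uniqueProd_oplus (s : S.Deco V) :
    S.push (LinearEquiv.uniqueProd (R := ℝ) (M := V) (M₂ := PUnit.{u + 1})).toLinearMap
      (S.oplus 0 s) = s := by
  simp only [push_oplus, map_zero, zero_add]
  exact S.push_id s

theorem push_prodUnique_oplus (s : S.Deco V) :
    S.push (LinearEquiv.prodUnique (R := ℝ) (M := V) (M₂ := PUnit.{u + 1})).toLinearMap
      (S.oplus s 0) = s := by
  simp only [push_oplus, map_zero, add_zero]
  exact S.push_id s

/-- The condition `S(0) ≅ 0`. -/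
class TrivialAtZero : Prop where
  subsingleton_deco : Subsingleton (S.Deco PUnit.{u + 1})

end DecorationFunctor

/-! ## Decorated linear relations -/

/-- An object of the category of `S`-decorated linear relations: a finite-dimensional real vector
space. -/
structure LinRel (S : DecorationFunctor.{u}) : Type (u + 1) where
  of ::
  carrier : Type u
  [addCommGroup : AddCommGroup carrier]
  [module : Module ℝ carrier]
  [finite : Module.Finite ℝ carrier]

attribute [instance] LinRel.addCommGroup LinRel.module LinRel.finite

namespace LinRel

variable {S : DecorationFunctor.{u}}

instance : CoeSort (LinRel S) (Type u) := ⟨LinRel.carrier⟩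

/-- A morphism `X ⟶ Y` of decorated linear relations: a subspace `D` of `Y` (the locus of
nondeterminism), a linear map `X → Y/D`, and a decoration on `Y/D`. -/
structure Hom (X Y : LinRel S) : Type u where
  locus : Submodule ℝ Y
  map : X →ₗ[ℝ] Y ⧸ locus
  deco : S.Deco (Y ⧸ locus)

namespace Hom

variable {X Y Z X' Y' Z' : LinRel S}

/-- The decorated relation `x ↦ f x + s + D` given by representatives on `Y` itself. -/
def rep (f : X →ₗ[ℝ] Y) (s : S.Deco Y) (D : Submodule ℝ Y) : Hom X Y where
  locus := D
  map := D.mkQ ∘ₗ f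
  deco := S.push D.mkQ s

/-- A linear map, seen as a decorated linear relation. -/
def pure (f : X →ₗ[ℝ] Y) : Hom X Y where
  locus := ⊥
  map := (⊥ : Submodule ℝ Y).mkQ ∘ₗ f
  deco := 0

/-- The subspace `E + f[D]` of `Z`, where `f : Y → Z/E` and `D ⊆ Y`. -/
def compLocus (φ : Hom X Y) (ψ : Hom Y Z) : Submodule ℝ Z :=
  (φ.locus.map ψ.map).comap ψ.locus.mkQ

theorem le_compLocus (φ : Hom X Y) (ψ : Hom Y Z) : ψ.locus ≤ compLocus φ ψ := by
  intro z hz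
  have h : ψ.locus.mkQ z = 0 := by simpa using hz
  simp only [compLocus, Submodule.mem_comap, h, Submodule.zero_mem]

/-- For `f : Y → Z/E` and `F = E + f[D]`, the composite `Y → Z/E → Z/F` vanishes on `D`; this is
the induced map `Y/D → Z/F`. -/
def compMap (φ : Hom X Y) (ψ : Hom Y Z) : (Y ⧸ φ.locus) →ₗ[ℝ] Z ⧸ compLocus φ ψ :=
  φ.locus.liftQ (Submodule.factor (le_compLocus φ ψ) ∘ₗ ψ.map) (by
    intro y hy
    obtain ⟨z, hz⟩ := ψ.locus.mkQ_surjective (ψ.map y)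
    simp only [LinearMap.mem_ker, LinearMap.comp_apply, ← hz, Submodule.factor_mk]
    exact (Submodule.Quotient.mk_eq_zero _).2 ⟨y, hy, hz.symm⟩)

/-- Composition (first `φ`, then `ψ`). -/
def comp (φ : Hom X Y) (ψ : Hom Y Z) : Hom X Z where
  locus := compLocus φ ψ
  map := compMap φ ψ ∘ₗ φ.map
  deco := S.push (compMap φ ψ) φ.deco + S.push (Submodule.factor (le_compLocus φ ψ)) ψ.deco

/-- The map `Y/D → (Y × Y')/(D × D')` induced by the inclusion of the first factor. -/
def inlQ (D : Submodule ℝ Y) (D' : Submodule ℝ Y') : (Y ⧸ D) →ₗ[ℝ] (Y × Y') ⧸ D.prod D' :=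
  D.mapQ (D.prod D') (LinearMap.inl ℝ Y Y') (fun y hy => by simpa using hy)

/-- The map `Y'/D' → (Y × Y')/(D × D')` induced by the inclusion of the second factor. -/
def inrQ (D : Submodule ℝ Y) (D' : Submodule ℝ Y') : (Y' ⧸ D') →ₗ[ℝ] (Y × Y') ⧸ D.prod D' :=
  D'.mapQ (D.prod D') (LinearMap.inr ℝ Y Y') (fun y hy => by simpa using hy)

/-- The tensor (parallel composition) of two decorated linear relations. -/
def tensor (φ : Hom X Y) (ψ : Hom X' Y') : Hom (of (X × X') : LinRel S) (of (Y × Y')) where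
  locus := φ.locus.prod ψ.locus
  map := inlQ φ.locus ψ.locus ∘ₗ φ.map ∘ₗ LinearMap.fst ℝ X X' +
    inrQ φ.locus ψ.locus ∘ₗ ψ.map ∘ₗ LinearMap.snd ℝ X X'
  deco := S.push (inlQ φ.locus ψ.locus) φ.deco + S.push (inrQ φ.locus ψ.locus) ψ.deco

/-! Representatives: every morphism comes from data on `Y` itself, and the operations can be
computed on representatives. -/

theorem exists_rep (φ : Hom X Y) : ∃ f s D, φ = rep f s D := by
  obtain ⟨D, f, s⟩ := φ
  obtain ⟨σ, hσ⟩ := D.mkQ.exists_rightInverse_of_surjective D.range_mkQ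
  refine ⟨σ ∘ₗ f, S.push σ s, D, ?_⟩
  simp only [rep, S.push_push, ← LinearMap.comp_assoc, hσ, S.push_id, LinearMap.id_comp]

theorem eq_rep (φ : Hom X Y) {f : X →ₗ[ℝ] Y} {s : S.Deco Y} {D : Submodule ℝ Y}
    (hD : φ.locus = D) (hf : Submodule.factor hD.le ∘ₗ φ.map = D.mkQ ∘ₗ f)
    (hs : S.push (Submodule.factor hD.le) φ.deco = S.push D.mkQ s) : φ = rep f s D := by
  obtain ⟨E, g, t⟩ := φ
  obtain rfl : E = D := hD
  have h : Submodule.factor (le_refl E) = LinearMap.id := by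
    ext x; rfl
  simp only [h, LinearMap.id_comp, S.push_id] at hf hs
  simp only [rep, hf, hs]

theorem rep_congr {f g : X →ₗ[ℝ] Y} {s t : S.Deco Y} {D E : Submodule ℝ Y}
    (hf : f = g) (hs : s = t) (hD : D = E) : rep f s D = rep g t E := by
  rw [hf, hs, hD]

theorem mk_congr {D : Submodule ℝ Y} {f g : X →ₗ[ℝ] Y ⧸ D} {s t : S.Deco (Y ⧸ D)}
    (hf : f = g) (hs : s = t) : Hom.mk D f s = Hom.mk D g t := by
  rw [hf, hs]

theorem pure_eq_rep (f : X →ₗ[ℝ] Y) : pure f = rep f 0 ⊥ := by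
  simp [pure, rep]

theorem rep_comp_rep (g : X →ₗ[ℝ] Y) (s : S.Deco Y) (D : Submodule ℝ Y)
    (f : Y →ₗ[ℝ] Z) (t : S.Deco Z) (E : Submodule ℝ Z) :
    comp (rep g s D) (rep f t E) = rep (f ∘ₗ g) (t + S.push f s) (E ⊔ D.map f) := by
  have hD : (comp (rep g s D) (rep f t E)).locus = E ⊔ D.map f := by
    simp only [comp, compLocus, rep, Submodule.map_comp]
    rw [Submodule.comap_map_eq, Submodule.ker_mkQ, sup_comm]
  have key : ∀ (h : compLocus (rep g s D) (rep f t E) ≤ E ⊔ D.map f),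
      Submodule.factor h ∘ₗ compMap (rep g s D) (rep f t E) ∘ₗ D.mkQ =
        (E ⊔ D.map f).mkQ ∘ₗ f := by
    intro h; ext y; rfl
  refine eq_rep _ hD ?_ ?_
  · have := key hD.le
    ext x
    exact LinearMap.congr_fun this (g x)
  · have h2 : (Submodule.factor hD.le ∘ₗ
        Submodule.factor (le_compLocus (rep g s D) (rep f t E))) ∘ₗ E.mkQ =
        (E ⊔ D.map f).mkQ := by
      ext y; rfl
    have h1 : (Submodule.factor hD.le ∘ₗ compMap (rep g s D) (rep f t E)) ∘ₗ D.mkQ =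
        (E ⊔ D.map f).mkQ ∘ₗ f := key hD.le
    have e1 := (S.push_push _ _ _).trans ((S.push_push _ _ s).trans
      (congrArg (fun l => S.push l s) h1))
    have e2 := (S.push_push _ _ _).trans ((S.push_push _ _ t).trans
      (congrArg (fun l => S.push l t) h2))
    have e3 : S.push (E ⊔ D.map f).mkQ (t + S.push f s) =
        S.push ((E ⊔ D.map f).mkQ ∘ₗ f) s + S.push (E ⊔ D.map f).mkQ t := by
      rw [map_add, S.push_push, add_comm]
    exact (map_add _ _ _).trans ((congrArg₂ (· + ·) e1 e2).trans e3.symm)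

theorem tensor_rep_rep (f : X →ₗ[ℝ] Y) (s : S.Deco Y) (D : Submodule ℝ Y)
    (g : X' →ₗ[ℝ] Y') (t : S.Deco Y') (E : Submodule ℝ Y') :
    tensor (rep f s D) (rep g t E) =
      rep (X := of (X × X')) (Y := of (Y × Y')) (f.prodMap g)
        (S.oplus s t) (D.prod E) := by
  have h1 : inlQ D E ∘ₗ D.mkQ = (D.prod E).mkQ ∘ₗ LinearMap.inl ℝ Y Y' := rfl
  have h2 : inrQ D E ∘ₗ E.mkQ = (D.prod E).mkQ ∘ₗ LinearMap.inr ℝ Y Y' := rfl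
  have hm : inlQ D E ∘ₗ (D.mkQ ∘ₗ f) ∘ₗ LinearMap.fst ℝ X X' +
      inrQ D E ∘ₗ (E.mkQ ∘ₗ g) ∘ₗ LinearMap.snd ℝ X X' = (D.prod E).mkQ ∘ₗ f.prodMap g := by
    simp only [← LinearMap.comp_assoc, h1, h2]
    simp only [LinearMap.comp_assoc, ← LinearMap.comp_add]
    congr 1
    ext <;> simp
  have e1 := ((S.push_push _ _ s).trans (congrArg (fun l => S.push l s) h1)).trans
    (S.push_push _ _ s).symm
  have e2 := ((S.push_push _ _ t).trans (congrArg (fun l => S.push l t) h2)).trans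
    (S.push_push _ _ t).symm
  have e3 := (congrArg₂ (· + ·) e1 e2).trans (map_add (S.push (D.prod E).mkQ) _ _).symm
  exact mk_congr (X := of (X × X')) (Y := of (Y × Y')) hm e3

end Hom

/-! ### The category, and its symmetric monoidal and copy-delete structure -/

instance : Category.{u} (LinRel S) where
  Hom X Y := Hom X Y
  id _ := Hom.pure LinearMap.id
  comp φ ψ := Hom.comp φ ψ
  id_comp φ := by
    obtain ⟨f, s, D, rfl⟩ := Hom.exists_rep φ
    rw [Hom.pure_eq_rep, Hom.rep_comp_rep]
    exact Hom.rep_congr (by simp) (by simp) (by simp)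
  comp_id φ := by
    obtain ⟨f, s, D, rfl⟩ := Hom.exists_rep φ
    rw [Hom.pure_eq_rep, Hom.rep_comp_rep]
    exact Hom.rep_congr (by simp) (by simp [S.push_id]) (by simp)
  assoc φ ψ χ := by
    obtain ⟨f, s, D, rfl⟩ := Hom.exists_rep φ
    obtain ⟨g, t, E, rfl⟩ := Hom.exists_rep ψ
    obtain ⟨h, r, F, rfl⟩ := Hom.exists_rep χ
    simp only [Hom.rep_comp_rep]
    exact Hom.rep_congr rfl (by simp [S.push_push, add_assoc])
      (by simp [Submodule.map_sup, Submodule.map_comp, sup_assoc])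

/-- The decorated relation `x ↦ f x + s + D`, as a morphism. -/
def rep {X Y : LinRel S} (f : X →ₗ[ℝ] Y) (s : S.Deco Y) (D : Submodule ℝ Y) : X ⟶ Y :=
  Hom.rep f s D

/-- A linear map, as a morphism. -/
def pure {X Y : LinRel S} (f : X →ₗ[ℝ] Y) : X ⟶ Y := Hom.pure f

theorem exists_rep {X Y : LinRel S} (φ : X ⟶ Y) : ∃ f s D, φ = rep f s D := Hom.exists_rep φ

theorem id_eq_rep (X : LinRel S) : 𝟙 X = rep LinearMap.id 0 ⊥ := Hom.pure_eq_rep _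

theorem pure_eq_rep {X Y : LinRel S} (f : X →ₗ[ℝ] Y) : pure f = rep f 0 ⊥ := Hom.pure_eq_rep _

theorem rep_comp_rep {X Y Z : LinRel S} (g : X →ₗ[ℝ] Y) (s : S.Deco Y) (D : Submodule ℝ Y)
    (f : Y →ₗ[ℝ] Z) (t : S.Deco Z) (E : Submodule ℝ Z) :
    rep g s D ≫ rep f t E = rep (f ∘ₗ g) (t + S.push f s) (E ⊔ D.map f) :=
  Hom.rep_comp_rep g s D f t E

theorem rep_congr {X Y : LinRel S} {f g : X →ₗ[ℝ] Y} {s t : S.Deco Y} {D E : Submodule ℝ Y}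
    (hf : f = g) (hs : s = t) (hD : D = E) : rep f s D = rep g t E :=
  Hom.rep_congr hf hs hD

theorem pure_comp_pure {X Y Z : LinRel S} (f : X →ₗ[ℝ] Y) (g : Y →ₗ[ℝ] Z) :
    (pure f ≫ pure g : X ⟶ Z) = pure (g ∘ₗ f) := by
  simp only [pure_eq_rep, rep_comp_rep]
  exact rep_congr rfl (by simp) (by simp)

/-- A linear equivalence, as an isomorphism. -/
def pureIso {X Y : LinRel S} (e : X ≃ₗ[ℝ] Y) : X ≅ Y where
  hom := pure e.toLinearMap
  inv := pure e.symm.toLinearMap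
  hom_inv_id := by rw [pure_comp_pure, e.symm_comp]; rfl
  inv_hom_id := by rw [pure_comp_pure, e.comp_symm]; rfl

instance : MonoidalCategoryStruct (LinRel S) where
  tensorObj X Y := of (X × Y)
  tensorUnit := of PUnit.{u + 1}
  tensorHom φ ψ := Hom.tensor φ ψ
  whiskerLeft X _ _ φ := Hom.tensor (Hom.pure (LinearMap.id : X →ₗ[ℝ] X)) φ
  whiskerRight φ X := Hom.tensor φ (Hom.pure (LinearMap.id : X →ₗ[ℝ] X))
  associator X Y Z := pureIso (X := of ((X × Y) × Z)) (Y := of (X × Y × Z))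
    (LinearEquiv.prodAssoc ℝ X Y Z)
  leftUnitor X := pureIso (X := of (PUnit.{u + 1} × X)) (LinearEquiv.uniqueProd)
  rightUnitor X := pureIso (X := of (X × PUnit.{u + 1})) (LinearEquiv.prodUnique)

theorem tensor_rep_rep {X Y X' Y' : LinRel S} (f : X →ₗ[ℝ] Y) (s : S.Deco Y) (D : Submodule ℝ Y)
    (g : X' →ₗ[ℝ] Y') (t : S.Deco Y') (E : Submodule ℝ Y') :
    (rep f s D ⊗ₘ rep g t E : X ⊗ X' ⟶ Y ⊗ Y') =
      rep (X := X ⊗ X') (Y := Y ⊗ Y') (f.prodMap g)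
        (S.oplus s t) (D.prod E) :=
  Hom.tensor_rep_rep f s D g t E

theorem tensor_pure_pure {X Y X' Y' : LinRel S} (f : X →ₗ[ℝ] Y) (g : X' →ₗ[ℝ] Y') :
    (pure f ⊗ₘ pure g : X ⊗ X' ⟶ Y ⊗ Y') =
      pure (X := X ⊗ X') (Y := Y ⊗ Y') (f.prodMap g) := by
  rw [pure_eq_rep, pure_eq_rep, tensor_rep_rep, pure_eq_rep]
  exact rep_congr rfl S.oplus_zero Submodule.prod_bot

theorem rep_comp_pure {X Y Z : LinRel S} (g : X →ₗ[ℝ] Y) (s : S.Deco Y) (D : Submodule ℝ Y)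
    (f : Y →ₗ[ℝ] Z) : (rep g s D ≫ pure f : X ⟶ Z) = rep (f ∘ₗ g) (S.push f s) (D.map f) := by
  rw [pure_eq_rep, rep_comp_rep]
  exact rep_congr rfl (by simp) (by simp)

theorem pure_comp_rep {X Y Z : LinRel S} (g : X →ₗ[ℝ] Y) (f : Y →ₗ[ℝ] Z) (s : S.Deco Z)
    (D : Submodule ℝ Z) : (pure g ≫ rep f s D : X ⟶ Z) = rep (f ∘ₗ g) s D := by
  rw [pure_eq_rep, rep_comp_rep]
  exact rep_congr rfl (by simp) (by simp)

theorem associator_hom_eq (X Y Z : LinRel S) : (α_ X Y Z).hom =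
    pure (X := (X ⊗ Y) ⊗ Z) (Y := X ⊗ Y ⊗ Z) (LinearEquiv.prodAssoc ℝ X Y Z).toLinearMap := rfl

theorem associator_inv_eq (X Y Z : LinRel S) : (α_ X Y Z).inv =
    pure (X := X ⊗ Y ⊗ Z) (Y := (X ⊗ Y) ⊗ Z)
      (LinearEquiv.prodAssoc ℝ X Y Z).symm.toLinearMap := rfl

theorem leftUnitor_hom_eq (X : LinRel S) : (λ_ X).hom =
    pure (X := 𝟙_ (LinRel S) ⊗ X) (Y := X) (LinearMap.snd ℝ PUnit.{u + 1} X) := rfl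

theorem locus_prodMap {V W V' W' : Type u} [AddCommGroup V] [Module ℝ V] [AddCommGroup W]
    [Module ℝ W] [AddCommGroup V'] [Module ℝ V'] [AddCommGroup W'] [Module ℝ W']
    (f : V →ₗ[ℝ] V') (g : W →ₗ[ℝ] W') (D : Submodule ℝ V) (E : Submodule ℝ W)
    (D' : Submodule ℝ V') (E' : Submodule ℝ W') :
    D'.prod E' ⊔ (D.prod E).map (f.prodMap g) = (D' ⊔ D.map f).prod (E' ⊔ E.map g) := by
  have h : (D.prod E).map (f.prodMap g) = (D.map f).prod (E.map g) := by
    ext ⟨x, y⟩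
    simp only [Submodule.mem_map, Submodule.mem_prod, LinearMap.prodMap_apply, Prod.exists,
      Prod.mk.injEq]
    constructor
    · rintro ⟨a, b, ⟨ha, hb⟩, rfl, rfl⟩
      exact ⟨⟨a, ha, rfl⟩, ⟨b, hb, rfl⟩⟩
    · rintro ⟨⟨a, ha, rfl⟩, ⟨b, hb, rfl⟩⟩
      exact ⟨a, b, ⟨ha, hb⟩, rfl, rfl⟩
  rw [h, Submodule.prod_sup_prod]

theorem locus_equiv {V W : Type u} [AddCommGroup V] [Module ℝ V] [AddCommGroup W]
    [Module ℝ W] (e : V ≃ₗ[ℝ] W) (D : Submodule ℝ V) (E : Submodule ℝ W)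
    (h : ∀ v, v ∈ D ↔ e v ∈ E) : D.map e.toLinearMap = E := by
  ext w
  constructor
  · rintro ⟨v, hv, rfl⟩
    exact (h v).1 hv
  · intro hw
    exact ⟨e.symm w, (h _).2 (by simpa using hw), by simp⟩

theorem associator_natural {X₁ X₂ X₃ Y₁ Y₂ Y₃ : LinRel S} (f₁ : X₁ →ₗ[ℝ] Y₁) (s₁ : S.Deco Y₁)
    (D₁ : Submodule ℝ Y₁) (f₂ : X₂ →ₗ[ℝ] Y₂) (s₂ : S.Deco Y₂) (D₂ : Submodule ℝ Y₂)
    (f₃ : X₃ →ₗ[ℝ] Y₃) (s₃ : S.Deco Y₃) (D₃ : Submodule ℝ Y₃) :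
    ((rep f₁ s₁ D₁ ⊗ₘ rep f₂ s₂ D₂) ⊗ₘ rep f₃ s₃ D₃) ≫ (α_ Y₁ Y₂ Y₃).hom =
      (α_ X₁ X₂ X₃).hom ≫ (rep f₁ s₁ D₁ ⊗ₘ (rep f₂ s₂ D₂ ⊗ₘ rep f₃ s₃ D₃)) := by
  have e₁ := tensor_rep_rep (X := X₁ ⊗ X₂) (Y := Y₁ ⊗ Y₂) (f₁.prodMap f₂) (S.oplus s₁ s₂)
    (D₁.prod D₂) f₃ s₃ D₃
  have e₂ := tensor_rep_rep (X' := X₂ ⊗ X₃) (Y' := Y₂ ⊗ Y₃) f₁ s₁ D₁ (f₂.prodMap f₃)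
    (S.oplus s₂ s₃) (D₂.prod D₃)
  rw [tensor_rep_rep f₁, tensor_rep_rep f₂, e₁, e₂, associator_hom_eq, associator_hom_eq,
    rep_comp_pure, pure_comp_rep]
  have h₁ := S.push_prodAssoc_oplus s₁ s₂ s₃
  have h₂ := locus_equiv (LinearEquiv.prodAssoc ℝ Y₁ Y₂ Y₃) ((D₁.prod D₂).prod D₃)
    (D₁.prod (D₂.prod D₃)) (fun _ => and_assoc)
  refine rep_congr ?_ ?_ ?_
  · rfl
  · exact h₁
  · exact h₂

instance : MonoidalCategory (LinRel S) := .ofTensorHom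
  (id_tensorHom_id := fun X Y => by
    change (pure _ ⊗ₘ pure _ : X ⊗ Y ⟶ X ⊗ Y) = pure _
    rw [tensor_pure_pure, LinearMap.prodMap_id])
  (id_tensorHom := fun _ _ _ _ => rfl)
  (tensorHom_id := fun _ _ => rfl)
  (tensorHom_comp_tensorHom := fun φ₁ φ₂ ψ₁ ψ₂ => by
    obtain ⟨f₁, s₁, D₁, rfl⟩ := exists_rep φ₁
    obtain ⟨f₂, s₂, D₂, rfl⟩ := exists_rep φ₂
    obtain ⟨g₁, t₁, E₁, rfl⟩ := exists_rep ψ₁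
    obtain ⟨g₂, t₂, E₂, rfl⟩ := exists_rep ψ₂
    rw [rep_comp_rep, rep_comp_rep, tensor_rep_rep, tensor_rep_rep, tensor_rep_rep]
    refine (rep_comp_rep _ _ _ _ _ _).trans (rep_congr rfl ?_ (locus_prodMap _ _ _ _ _ _))
    exact (congrArg _ (S.push_prodMap_oplus _ _ _ _)).trans (S.oplus_add _ _ _ _).symm)
  (associator_naturality := fun φ₁ φ₂ φ₃ => by
    obtain ⟨f₁, s₁, D₁, rfl⟩ := exists_rep φ₁
    obtain ⟨f₂, s₂, D₂, rfl⟩ := exists_rep φ₂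
    obtain ⟨f₃, s₃, D₃, rfl⟩ := exists_rep φ₃
    exact associator_natural _ _ _ _ _ _ _ _ _)
  (leftUnitor_naturality := fun φ => by
    obtain ⟨f, s, D, rfl⟩ := exists_rep φ
    rw [id_eq_rep, tensor_rep_rep]
    refine (rep_comp_pure _ _ _ _).trans (Eq.trans ?_ (pure_comp_rep _ _ _ _).symm)
    exact rep_congr rfl (S.push_uniqueProd_oplus _)
      (locus_equiv _ _ _ fun _ => and_iff_right (Subsingleton.elim (α := PUnit.{u + 1}) _ _)))
  (rightUnitor_naturality := fun φ => by
    obtain ⟨f, s, D, rfl⟩ := exists_rep φ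
    rw [id_eq_rep, tensor_rep_rep]
    refine (rep_comp_pure _ _ _ _).trans (Eq.trans ?_ (pure_comp_rep _ _ _ _).symm)
    exact rep_congr rfl (S.push_prodUnique_oplus _)
      (locus_equiv _ _ _ fun _ => and_iff_left (Subsingleton.elim (α := PUnit.{u + 1}) _ _)))
  (pentagon := fun W X Y Z => by
    change (pure _ ⊗ₘ pure _) ≫ pure _ ≫ (pure _ ⊗ₘ pure _) = pure _ ≫ pure _
    simp only [tensor_pure_pure]
    refine (congrArg (_ ≫ ·) (pure_comp_pure _ _)).trans ((pure_comp_pure _ _).trans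
      (Eq.trans ?_ (pure_comp_pure _ _).symm))
    rfl)
  (triangle := fun X Y => by
    change pure _ ≫ (pure _ ⊗ₘ pure _) = (pure _ ⊗ₘ pure _)
    simp only [tensor_pure_pure]
    exact pure_comp_pure _ _)

theorem whiskerLeft_pure (X : LinRel S) {Y Z : LinRel S} (f : Y →ₗ[ℝ] Z) :
    (X ◁ pure f : X ⊗ Y ⟶ X ⊗ Z) =
      pure (X := X ⊗ Y) (Y := X ⊗ Z) (LinearMap.id.prodMap f) :=
  tensor_pure_pure _ _

theorem pure_whiskerRight (X : LinRel S) {Y Z : LinRel S} (f : Y →ₗ[ℝ] Z) :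
    (pure f ▷ X : Y ⊗ X ⟶ Z ⊗ X) =
      pure (X := Y ⊗ X) (Y := Z ⊗ X) (f.prodMap LinearMap.id) :=
  tensor_pure_pure _ _

/-- The symmetry `(x, y) ↦ (y, x)`. -/
def swapIso (X Y : LinRel S) : X ⊗ Y ≅ Y ⊗ X :=
  pureIso (X := X ⊗ Y) (Y := Y ⊗ X) (LinearEquiv.prodComm ℝ X Y)

theorem swapIso_hom (X Y : LinRel S) : (swapIso X Y).hom =
    pure (X := X ⊗ Y) (Y := Y ⊗ X) (LinearEquiv.prodComm ℝ X Y).toLinearMap := rfl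

instance : SymmetricCategory (LinRel S) where
  braiding X Y := swapIso X Y
  braiding_naturality_right X Y Z φ := by
    obtain ⟨f, s, D, rfl⟩ := exists_rep φ
    rw [← id_tensorHom, ← tensorHom_id, id_eq_rep, tensor_rep_rep, tensor_rep_rep, swapIso_hom,
      swapIso_hom, rep_comp_pure, pure_comp_rep]
    exact rep_congr rfl (S.push_prodComm_oplus _ _) (locus_equiv _ _ _ fun _ => and_comm)
  braiding_naturality_left φ Z := by
    obtain ⟨f, s, D, rfl⟩ := exists_rep φ
    rw [← id_tensorHom, ← tensorHom_id, id_eq_rep, tensor_rep_rep, tensor_rep_rep, swapIso_hom,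
      swapIso_hom, rep_comp_pure, pure_comp_rep]
    exact rep_congr rfl (S.push_prodComm_oplus _ _) (locus_equiv _ _ _ fun _ => and_comm)
  hexagon_forward X Y Z := by
    simp only [swapIso_hom, associator_hom_eq, whiskerLeft_pure, pure_whiskerRight, pure_comp_pure]
    rfl
  hexagon_reverse X Y Z := by
    simp only [swapIso_hom, associator_inv_eq, whiskerLeft_pure, pure_whiskerRight, pure_comp_pure]
    rfl
  symmetry X Y := by
    simp only [swapIso_hom, pure_comp_pure]
    rfl

theorem braiding_hom_eq (X Y : LinRel S) : (β_ X Y).hom =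
    pure (X := X ⊗ Y) (Y := Y ⊗ X) (LinearEquiv.prodComm ℝ X Y).toLinearMap := rfl

/-- Copying `x ↦ (x, x)`. -/
def copy (X : LinRel S) : X ⟶ X ⊗ X :=
  pure (X := X) (Y := X ⊗ X) (LinearMap.id.prod LinearMap.id)

/-- Deleting `x ↦ 0`. -/
def delete (X : LinRel S) : X ⟶ 𝟙_ (LinRel S) :=
  pure (X := X) (Y := 𝟙_ (LinRel S)) 0

instance (X : LinRel S) : ComonObj X where
  counit := delete X
  comul := copy X
  counit_comul := by
    simp only [copy, delete, pure_whiskerRight, pure_comp_pure]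
    rfl
  comul_counit := by
    simp only [copy, delete, whiskerLeft_pure, pure_comp_pure]
    rfl
  comul_assoc := by
    simp only [copy, associator_hom_eq, whiskerLeft_pure, pure_whiskerRight, pure_comp_pure]
    rfl

theorem copy_eq (X : LinRel S) :
    Δ[X] = pure (X := X) (Y := X ⊗ X) (LinearMap.id.prod LinearMap.id) := rfl

theorem delete_eq (X : LinRel S) : ε[X] = pure (X := X) (Y := 𝟙_ (LinRel S)) 0 := rfl

instance : CopyDiscardCategory (LinRel S) where
  isCommComonObj X := ⟨by
    simp only [copy_eq, braiding_hom_eq, pure_comp_pure]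
    rfl⟩
  copy_tensor X Y := by
    simp only [tensorμ, copy_eq, braiding_hom_eq, associator_hom_eq, associator_inv_eq,
      whiskerLeft_pure, pure_whiskerRight, tensor_pure_pure, pure_comp_pure]
    rfl
  discard_tensor X Y := by
    simp only [delete_eq, leftUnitor_hom_eq, tensor_pure_pure, pure_comp_pure]
    rfl
  copy_unit := rfl
  discard_unit := rfl

instance [S.TrivialAtZero] : MarkovCategory (LinRel S) where
  discard_natural φ := by
    obtain ⟨f, s, D, rfl⟩ := exists_rep φ
    have := DecorationFunctor.TrivialAtZero.subsingleton_deco (S := S)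
    rw [delete_eq, delete_eq, rep_comp_pure, pure_eq_rep]
    exact rep_congr (LinearMap.zero_comp f) (Subsingleton.elim (α := S.Deco PUnit.{u + 1}) _ _)
      (Subsingleton.elim (α := Submodule ℝ PUnit.{u + 1}) _ _)

end LinRel

/-! ## Gaussian distributions and extended Gaussian maps -/

section Gaussian

variable {V W Z : Type u} [AddCommGroup V] [Module ℝ V] [AddCommGroup W] [Module ℝ W]
  [AddCommGroup Z] [Module ℝ Z]

variable (V) in
/-- Covariance forms on `V`: positive semidefinite symmetric bilinear forms on the dual space, a
commutative monoid under pointwise addition. -/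
def Cov : AddSubmonoid (LinearMap.BilinForm ℝ (Module.Dual ℝ V)) where
  carrier := {σ | σ.IsPosSemidef}
  add_mem' hσ hτ := hσ.add hτ
  zero_mem' := LinearMap.BilinForm.isPosSemidef_zero

/-- Pushforward of covariance forms, `(f_* σ)(g, h) = σ(g ∘ f, h ∘ f)`. -/
def Cov.push (f : V →ₗ[ℝ] W) : Cov V →+ Cov W where
  toFun σ := ⟨σ.1.comp f.dualMap f.dualMap,
    { eq := fun g h => σ.2.eq (f.dualMap g) (f.dualMap h)
      nonneg := fun g => σ.2.nonneg (f.dualMap g) }⟩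
  map_zero' := rfl
  map_add' _ _ := rfl

variable (V) in
/-- A Gaussian distribution `𝒩(μ, Σ)` on `V`: a mean `μ ∈ V` and a covariance form `Σ`. -/
abbrev GaussianDist : Type u := V × Cov V

/-- Pushforward of Gaussian distributions, `f_* 𝒩(μ, Σ) = 𝒩(f μ, f_* Σ)`. -/
def GaussianDist.push (f : V →ₗ[ℝ] W) : GaussianDist V →+ GaussianDist W :=
  f.toAddMonoidHom.prodMap (Cov.push f)

end Gaussian

/-- The decoration functor `X ↦ X × Cov(X)`. -/
def gaussianDecoration : DecorationFunctor.{u} where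
  obj V := AddCommMonCat.of (GaussianDist V)
  map f := AddCommMonCat.ofHom (GaussianDist.push f.hom.hom)
  map_id _ := rfl
  map_comp _ _ := rfl

instance : gaussianDecoration.{u}.TrivialAtZero where
  subsingleton_deco := by
    change Subsingleton (PUnit.{u + 1} × Cov PUnit.{u + 1})
    have : Subsingleton (Cov PUnit.{u + 1}) := ⟨fun σ τ => by
      apply Subtype.ext
      ext g h
      rw [Subsingleton.elim g 0]
      simp⟩
    infer_instance

/-- The category of finite-dimensional real vector spaces and extended Gaussian maps. -/
abbrev GaussEx : Type (u + 1) := LinRel gaussianDecoration.{u}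

/-- An extended Gaussian distribution on `V`: a subspace `D` of `V` (the locus of nondeterminism)
and a Gaussian distribution on `V/D`. -/
structure ExtendedGaussian (V : Type u) [AddCommGroup V] [Module ℝ V] : Type u where
  locus : Submodule ℝ V
  dist : GaussianDist (V ⧸ locus)

namespace ExtendedGaussian

/-- Pushforward along a linear map `f`: the locus is `f[D]`, and the Gaussian distribution on the
quotient is pushed along the induced map `V/D → W/f[D]`. -/
def push {V W : Type u} [AddCommGroup V] [Module ℝ V] [AddCommGroup W] [Module ℝ W]
    (f : V →ₗ[ℝ] W) (ψ : ExtendedGaussian V) : ExtendedGaussian W where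
  locus := ψ.locus.map f
  dist := GaussianDist.push (ψ.locus.mapQ (ψ.locus.map f) f (Submodule.le_comap_map f ψ.locus))
    ψ.dist

/-- An extended Gaussian distribution on `X`, as an extended Gaussian map out of the trivial
vector space. -/
def toHom {X : GaussEx.{u}} (ψ : ExtendedGaussian X) : 𝟙_ GaussEx.{u} ⟶ X :=
  LinRel.Hom.mk ψ.locus 0 ψ.dist

end ExtendedGaussian

/-! ## Conditionals in a Markov category -/

section Conditionals

variable {C : Type*} [Category C] [MonoidalCategory C] [MarkovCategory C]

/-- The marginal `A ⟶ X` of `f : A ⟶ X ⊗ Y`. -/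
def marginalFst {A X Y : C} (f : A ⟶ X ⊗ Y) : A ⟶ X := f ≫ X ◁ ε[Y] ≫ (ρ_ X).hom

/-- `k : X ⊗ A ⟶ Y` is a conditional of `f : A ⟶ X ⊗ Y` with respect to `X`: `f` is recovered by
copying the input `a`, sampling `x` from the marginal at `a`, copying `x`, and then sampling `y`
from `k` at `(x, a)`. -/
def IsConditional {A X Y : C} (f : A ⟶ X ⊗ Y) (k : X ⊗ A ⟶ Y) : Prop :=
  f = Δ[A] ≫ (marginalFst f ≫ Δ[X]) ▷ A ≫ (α_ X X A).hom ≫ X ◁ k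

variable (C) in
/-- A Markov category has (all) conditionals. -/
def HasConditionals : Prop :=
  ∀ {A X Y : C} (f : A ⟶ X ⊗ Y), ∃ k : X ⊗ A ⟶ Y, IsConditional f k

end Conditionals

/-!
A morphism `φ : A → X × Y` is represented by a linear map `f`, a Gaussian `s` on `X × Y` and a
subspace `D`, where `s` and `f` only matter modulo `D`. A conditional is sought of the form
`k (x, a) = h x + (f₂ a - h (f₁ a)) + t + E`, where `h : X → Y` is linear, `t` is the law of the
residual `y - h x` under `s`, and `E = {y | (0, y) ∈ D}`. The linear parts of the two sides then
agree identically, and the remaining requirements concern `h` alone.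

* The loci agree as soon as `h` is a selection of `D`: `(x, h x) ∈ D` for every `x` in the
  projection `D₁` of `D` to `X`.
* The Gaussians agree modulo `D` as soon as `(x, h x)` and the residual `(0, y - h x)` are
  uncorrelated in `(X × Y) / D`, because `(x, y)` is their sum.

Let `p` be a projection of `X` with kernel `D₁` and let `h₀` be a selection of `D`. Put
`h = h₀ (1 - p) + h' p`. This is a selection whatever `h'` is, and modulo `D` the vector
`(x, h x)` depends only on `p x`. Hence it suffices that `p x` is uncorrelated with
`(y - h₀ (1 - p) x) - h' (p x)`, so that `h'` is a linear regression of `y - h₀ (1 - p) x` on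
`p x`. A regression map exists even when the covariance of `p x` is degenerate: by the
Cauchy–Schwarz inequality, a functional with zero variance has zero covariance with everything, so
the normal equations are solvable (`LinearMap.BilinForm.exists_regression`). The choice of `h` is
`GaussianDist.exists_disintegration`.
-/

/-- Linear regression for a possibly degenerate covariance form: the map `k` solves the normal
equations. With `Γ = σ(p ·, p ·)`, the functional `σ(q β, p ·)` vanishes on the kernel of `Γ` by the
Cauchy–Schwarz inequality, hence lies in the range of `Γ`. -/
theorem LinearMap.BilinForm.exists_regression {M N₁ N₂ : Type*} [AddCommGroup M] [Module ℝ M]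
    [AddCommGroup N₁] [Module ℝ N₁] [Module.Finite ℝ N₁] [AddCommGroup N₂] [Module ℝ N₂]
    {σ : LinearMap.BilinForm ℝ M} (hσ : σ.IsPosSemidef) (p : N₁ →ₗ[ℝ] M) (q : N₂ →ₗ[ℝ] M) :
    ∃ k : N₂ →ₗ[ℝ] N₁, ∀ α β, σ (p α) (q β) = σ (p α) (p (k β)) := by
  let Γ : N₁ →ₗ[ℝ] Module.Dual ℝ N₁ := σ.compl₁₂ p p
  let R : N₂ →ₗ[ℝ] Module.Dual ℝ N₁ := σ.compl₁₂ q p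
  have hsymm : ∀ x y, σ x y = σ y x := fun x y => hσ.eq x y
  have hflip : Γ.flip = Γ := by
    ext α α'
    exact hsymm _ _
  have hR : ∀ β, R β ∈ Γ.range := by
    intro β
    rw [← hflip, ← LinearMap.dualAnnihilator_ker_eq_range_flip, Submodule.mem_dualAnnihilator]
    intro α hα
    have h0 : σ (p α) (p α) = 0 := LinearMap.congr_fun hα α
    have hCS := LinearMap.BilinForm.apply_mul_apply_le_of_forall_zero_le σ hσ.nonneg (q β) (p α)
    rw [h0, mul_zero, hsymm (p α), ← sq] at hCS
    exact sq_eq_zero_iff.1 (le_antisymm hCS (sq_nonneg _))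
  obtain ⟨k, hk⟩ := Module.projective_lifting_property Γ.rangeRestrict (R.codRestrict _ hR)
    Γ.surjective_rangeRestrict
  refine ⟨k, fun α β => ?_⟩
  have h : Γ (k β) = R β := congrArg Subtype.val (LinearMap.congr_fun hk β)
  rw [hsymm, hsymm (p α)]
  exact (LinearMap.congr_fun h α).symm

theorem LinearMap.exists_dualMap_eq {V W : Type*} [AddCommGroup V] [Module ℝ V]
    [Module.Finite ℝ V] [AddCommGroup W] [Module ℝ W] [Module.Finite ℝ W]
    (k : Module.Dual ℝ W →ₗ[ℝ] Module.Dual ℝ V) : ∃ h : V →ₗ[ℝ] W, h.dualMap = k := by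
  refine ⟨(Module.evalEquiv ℝ W).symm.toLinearMap ∘ₗ k.dualMap ∘ₗ Module.Dual.eval ℝ V, ?_⟩
  ext β v
  simp

/-- A linear relation `D` from `V` to `W` contains the graph of a linear map over its domain. -/
theorem Submodule.exists_selection {V W : Type*} [AddCommGroup V] [Module ℝ V]
    [AddCommGroup W] [Module ℝ W] (D : Submodule ℝ (V × W)) :
    ∃ h : V →ₗ[ℝ] W, ∀ x ∈ D.map (LinearMap.fst ℝ V W), (x, h x) ∈ D := by
  obtain ⟨r, hr⟩ := ((LinearMap.fst ℝ V W).submoduleMap D).exists_rightInverse_of_surjective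
    (LinearMap.range_eq_top.2 (LinearMap.submoduleMap_surjective _ _))
  obtain ⟨h, hh⟩ := LinearMap.exists_extend (LinearMap.snd ℝ V W ∘ₗ D.subtype ∘ₗ r)
  refine ⟨h, fun x hx => ?_⟩
  have h1 := congrArg Subtype.val (LinearMap.congr_fun hr ⟨x, hx⟩)
  have h2 := LinearMap.congr_fun hh ⟨x, hx⟩
  have : (x, h x) = (r ⟨x, hx⟩ : V × W) := Prod.ext h1.symm h2
  exact this ▸ (r ⟨x, hx⟩).2

/-- A linear relation is recovered from its fibre over `0` and a linear selection over its
domain. -/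
theorem Submodule.map_inr_comap_inr_sup_map_selection {V W : Type*} [AddCommGroup V] [Module ℝ V]
    [AddCommGroup W] [Module ℝ W] {D : Submodule ℝ (V × W)} {h : V →ₗ[ℝ] W}
    (hh : ∀ x ∈ D.map (LinearMap.fst ℝ V W), (x, h x) ∈ D) :
    (D.comap (LinearMap.inr ℝ V W)).map (LinearMap.inr ℝ V W) ⊔
      (D.map (LinearMap.fst ℝ V W)).map (LinearMap.id.prod h) = D := by
  refine le_antisymm (sup_le (Submodule.map_comap_le _ _) ?_) fun z hz => ?_
  · rintro _ ⟨x, hx, rfl⟩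
    exact hh x hx
  · have hx : z.1 ∈ D.map (LinearMap.fst ℝ V W) := ⟨z, hz, rfl⟩
    refine Submodule.mem_sup.2 ⟨(0, z.2 - h z.1), ⟨z.2 - h z.1, ?_, rfl⟩, (z.1, h z.1),
      ⟨z.1, hx, rfl⟩, by simp⟩
    have hsub : ((0, z.2 - h z.1) : V × W) = z - (z.1, h z.1) := by ext <;> simp
    change ((0, z.2 - h z.1) : V × W) ∈ D
    exact hsub ▸ D.sub_mem hz (hh _ hx)

namespace GaussianDist

theorem push_push {U V W : Type u} [AddCommGroup U] [Module ℝ U] [AddCommGroup V] [Module ℝ V]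
    [AddCommGroup W] [Module ℝ W] (g : V →ₗ[ℝ] W) (f : U →ₗ[ℝ] V) (s : GaussianDist U) :
    push g (push f s) = push (g ∘ₗ f) s := rfl

/-- Jointly Gaussian vectors `A u` and `B u` that are uncorrelated are independent: the law of their
sum is the sum (convolution) of their laws. -/
theorem push_add_push {U W : Type u} [AddCommGroup U] [Module ℝ U] [AddCommGroup W]
    [Module ℝ W] {A B : U →ₗ[ℝ] W} {s : GaussianDist U}
    (h : ∀ g g' : Module.Dual ℝ W, s.2.1 (g ∘ₗ A) (g' ∘ₗ B) = 0) :
    push A s + push B s = push (A + B) s := by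
  refine Prod.ext rfl (Subtype.ext ?_)
  ext g g'
  change s.2.1 (g ∘ₗ A) (g' ∘ₗ A) + s.2.1 (g ∘ₗ B) (g' ∘ₗ B) =
    s.2.1 (g ∘ₗ (A + B)) (g' ∘ₗ (A + B))
  have hsymm : s.2.1 (g ∘ₗ B) (g' ∘ₗ A) = s.2.1 (g' ∘ₗ A) (g ∘ₗ B) := s.2.2.eq _ _
  simp only [LinearMap.comp_add, map_add, LinearMap.add_apply, h, hsymm]
  ring

/-- A Gaussian vector `(x, y)` splits, modulo `D`, into the independent summands `(x, h x)` and
`(0, y - h x)`, for some linear `h` whose graph over the projection of `D` lies in `D`. -/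
theorem exists_disintegration {X Y : Type u} [AddCommGroup X] [Module ℝ X] [Module.Finite ℝ X]
    [AddCommGroup Y] [Module ℝ Y] [Module.Finite ℝ Y] (D : Submodule ℝ (X × Y))
    (s : GaussianDist (X × Y)) :
    ∃ h : X →ₗ[ℝ] Y, (∀ x ∈ D.map (LinearMap.fst ℝ X Y), (x, h x) ∈ D) ∧
      push D.mkQ (push (LinearMap.inr ℝ X Y) (push (LinearMap.snd ℝ X Y - h ∘ₗ .fst ℝ X Y) s) +
        push (LinearMap.id.prod h) (push (LinearMap.fst ℝ X Y) s)) = push D.mkQ s := by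
  obtain ⟨h₀, hh₀⟩ := D.exists_selection
  set D₁ := D.map (LinearMap.fst ℝ X Y)
  -- `p` is a linear projection with kernel exactly `D₁`.
  obtain ⟨r, hr⟩ := D₁.mkQ.exists_rightInverse_of_surjective D₁.range_mkQ
  let p : X →ₗ[ℝ] X := r ∘ₗ D₁.mkQ
  have hp₀ : ∀ x ∈ D₁, p x = 0 := fun x hx => by
    simp [p, (Submodule.Quotient.mk_eq_zero D₁).2 hx]
  have hp : ∀ x, x - p x ∈ D₁ := fun x => by
    rw [← Submodule.Quotient.mk_eq_zero, Submodule.Quotient.mk_sub, sub_eq_zero]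
    exact (LinearMap.congr_fun hr (D₁.mkQ x)).symm
  obtain ⟨k, hk⟩ := LinearMap.BilinForm.exists_regression s.2.2
    (p ∘ₗ LinearMap.fst ℝ X Y).dualMap
    (LinearMap.snd ℝ X Y - h₀ ∘ₗ (LinearMap.id - p) ∘ₗ LinearMap.fst ℝ X Y).dualMap
  obtain ⟨h', rfl⟩ := LinearMap.exists_dualMap_eq k
  let h := h₀ ∘ₗ (LinearMap.id - p) + h' ∘ₗ p
  have hh : ∀ x ∈ D₁, (x, h x) ∈ D := fun x hx => by simpa [h, hp₀ x hx] using hh₀ x hx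
  refine ⟨h, hh, ?_⟩
  rw [map_add, push_push, push_push, push_push, push_push, add_comm, push_add_push]
  · refine congrArg (fun l => push l s) (LinearMap.ext fun z => ?_)
    refine congrArg D.mkQ (a₁ := ((z.1, h z.1) + (0, z.2 - h z.1) : X × Y)) ?_
    simp
  intro g g'
  -- Modulo `D`, `(x, h x)` depends only on `p x`, since `x - p x ∈ D₁`.
  have hA : g ∘ₗ D.mkQ ∘ₗ LinearMap.id.prod h ∘ₗ LinearMap.fst ℝ X Y =
      (p ∘ₗ LinearMap.fst ℝ X Y).dualMap (g ∘ₗ D.mkQ ∘ₗ LinearMap.id.prod h) := by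
    refine LinearMap.ext fun z => congrArg g ?_
    refine (Submodule.Quotient.eq D).2 ?_
    simpa using hh _ (hp z.1)
  have hB : g' ∘ₗ D.mkQ ∘ₗ LinearMap.inr ℝ X Y ∘ₗ (LinearMap.snd ℝ X Y - h ∘ₗ .fst ℝ X Y) =
      (LinearMap.snd ℝ X Y - h₀ ∘ₗ (LinearMap.id - p) ∘ₗ LinearMap.fst ℝ X Y).dualMap
          (g' ∘ₗ D.mkQ ∘ₗ .inr ℝ X Y) -
        (p ∘ₗ LinearMap.fst ℝ X Y).dualMap (h'.dualMap (g' ∘ₗ D.mkQ ∘ₗ .inr ℝ X Y)) := by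
    refine LinearMap.ext fun z => ?_
    simp only [LinearMap.sub_apply, LinearMap.dualMap_apply]
    rw [← map_sub]
    refine congrArg (fun y => g' (D.mkQ (0, y))) ?_
    simp [h, sub_sub]
  exact (congrArg₂ (fun a b => s.2.1 a b) hA hB).trans
    ((map_sub _ _ _).trans (sub_eq_zero.2 (hk _ _)))

theorem push_mkQ_surjective {V : Type u} [AddCommGroup V] [Module ℝ V] (D : Submodule ℝ V) :
    Function.Surjective (push D.mkQ) := by
  obtain ⟨r, hr⟩ := D.mkQ.exists_rightInverse_of_surjective D.range_mkQ
  exact fun s => ⟨push r s, by rw [push_push, hr]; rfl⟩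

end GaussianDist

namespace LinRel

variable {S : DecorationFunctor.{u}}

/-- Representatives of a morphism need their decorations to agree only modulo the locus. -/
theorem rep_congr_mkQ {X Y : LinRel S} {f g : X →ₗ[ℝ] Y} {s t : S.Deco Y} {D E : Submodule ℝ Y}
    (hD : D = E) (hf : f = g) (hs : S.push E.mkQ s = S.push E.mkQ t) :
    rep f s D = rep g t E := by
  subst hD hf
  exact Hom.mk_congr rfl hs

theorem marginalFst_rep {A X Y : GaussEx.{u}} (f : A →ₗ[ℝ] X × Y) (s : GaussianDist (X × Y))
    (D : Submodule ℝ (X × Y)) :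
    marginalFst (rep (X := A) (Y := X ⊗ Y) f s D) =
      rep (LinearMap.fst ℝ X Y ∘ₗ f) (GaussianDist.push (LinearMap.fst ℝ X Y) s)
        (D.map (LinearMap.fst ℝ X Y)) := by
  have h : (X ◁ ε[Y] ≫ (ρ_ X).hom : X ⊗ Y ⟶ X) =
      pure (X := X ⊗ Y) (Y := X) (LinearMap.fst ℝ X Y) := by
    rw [delete_eq, whiskerLeft_pure]
    exact pure_comp_pure _ _
  rw [marginalFst, h]
  exact rep_comp_pure _ _ _ _

theorem copy_comp_whiskerLeft_rep {X Y : LinRel S} (g : X →ₗ[ℝ] Y) (t : S.Deco Y)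
    (E : Submodule ℝ Y) :
    Δ[X] ≫ X ◁ rep g t E = rep (X := X) (Y := X ⊗ Y) (LinearMap.id.prod g)
      (S.push (LinearMap.inr ℝ X Y) t) (E.map (LinearMap.inr ℝ X Y)) := by
  rw [copy_eq, ← id_tensorHom, id_eq_rep, tensor_rep_rep]
  refine (pure_comp_rep _ _ _ _).trans (rep_congr ?_ ?_ ?_)
  · rfl
  · simp [DecorationFunctor.oplus]
  · ext ⟨x, y⟩
    simp [Submodule.mem_prod, eq_comm (a := (0 : X)), and_comm]

/-- The composite of the marginal `rep f s D` with the candidate conditional `rep g t E`, as in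
`IsConditional`: it is `a ↦ (x, g (x, a) + t + E)` with `x = f a + s + D`. -/
theorem copy_comp_whiskerRight_comp_whiskerLeft {A X Y : LinRel S} (f : A →ₗ[ℝ] X)
    (s : S.Deco X) (D : Submodule ℝ X) (g : (X × A) →ₗ[ℝ] Y) (t : S.Deco Y)
    (E : Submodule ℝ Y) :
    Δ[A] ≫ (rep f s D ≫ Δ[X]) ▷ A ≫ (α_ X X A).hom ≫ X ◁ rep (X := X ⊗ A) g t E =
      rep (X := A) (Y := X ⊗ Y) (f.prod (g ∘ₗ f.prod LinearMap.id))
        (S.push (LinearMap.inr ℝ X Y) t + S.push (LinearMap.id.prod (g ∘ₗ .inl ℝ X A)) s)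
        (E.map (LinearMap.inr ℝ X Y) ⊔ D.map (LinearMap.id.prod (g ∘ₗ .inl ℝ X A))) := by
  have h₁ : Δ[X] ▷ A ≫ (α_ X X A).hom ≫ X ◁ rep (X := X ⊗ A) g t E =
      rep (X := X ⊗ A) (Y := X ⊗ Y) ((LinearMap.fst ℝ X A).prod g)
        (S.push (LinearMap.inr ℝ X Y) t) (E.map (LinearMap.inr ℝ X Y)) := by
    rw [copy_eq, pure_whiskerRight, associator_hom_eq, ← Category.assoc, pure_comp_pure,
      ← id_tensorHom, id_eq_rep, tensor_rep_rep]
    refine (pure_comp_rep _ _ _ _).trans (rep_congr ?_ ?_ ?_)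
    · rfl
    · simp [DecorationFunctor.oplus]
    · ext ⟨x, y⟩
      simp [Submodule.mem_prod, eq_comm (a := (0 : X)), and_comm]
  have h₂ : Δ[A] ≫ rep f s D ▷ A = rep (X := A) (Y := X ⊗ A) (f.prod LinearMap.id)
      (S.push (LinearMap.inl ℝ X A) s) (D.map (LinearMap.inl ℝ X A)) := by
    rw [copy_eq, ← tensorHom_id, id_eq_rep, tensor_rep_rep]
    refine (pure_comp_rep _ _ _ _).trans (rep_congr ?_ ?_ ?_)
    · rfl
    · simp [DecorationFunctor.oplus]
    · ext ⟨x, y⟩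
      simp [Submodule.mem_prod, eq_comm]
  rw [comp_whiskerRight, Category.assoc, h₁, ← Category.assoc, h₂]
  refine (rep_comp_rep _ _ _ _ _ _).trans (rep_congr rfl ?_ ?_)
  · exact congrArg (_ + ·) (S.push_push _ _ s)
  · exact congrArg (_ ⊔ ·) (Submodule.map_comp _ _ _).symm

end LinRel

theorem hasConditionals_gaussEx : HasConditionals GaussEx.{u} := by
  intro A X Y φ
  obtain ⟨f, s, D, rfl⟩ := LinRel.exists_rep φ
  obtain ⟨h, hD, hs⟩ := GaussianDist.exists_disintegration (X := X) (Y := Y) D s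
  let f' : A →ₗ[ℝ] X × Y := f
  -- The dependence on `a` is fixed by `g (f₁ a, a) = f₂ a`.
  let g : X × A →ₗ[ℝ] Y :=
    h.coprod (LinearMap.snd ℝ X Y ∘ₗ f' - h ∘ₗ LinearMap.fst ℝ X Y ∘ₗ f')
  have hg : g ∘ₗ LinearMap.inl ℝ X A = h := LinearMap.coprod_inl _ _
  refine ⟨LinRel.rep (X := X ⊗ A) g
    (GaussianDist.push (LinearMap.snd ℝ X Y - h ∘ₗ LinearMap.fst ℝ X Y) s)
    (D.comap (LinearMap.inr ℝ X Y)), ?_⟩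
  refine Eq.trans ?_ (congrArg (fun m => Δ[A] ≫ (m ≫ Δ[X]) ▷ A ≫ _)
    (LinRel.marginalFst_rep f' s D)).symm
  refine Eq.trans ?_ (LinRel.copy_comp_whiskerRight_comp_whiskerLeft _ _ _ _ _ _).symm
  rw [hg]
  refine (LinRel.rep_congr_mkQ ?_ ?_ ?_).symm
  · exact Submodule.map_inr_comap_inr_sup_map_selection hD
  · refine LinearMap.ext fun a => Prod.ext rfl ?_
    simp [g, f']
  · exact hs

theorem corollary3p6 :
    HasConditionals GaussEx.{u} ∧
      ∀ (X Y : GaussEx.{u}) (ψ : ExtendedGaussian (X × Y)), ∃ k : X ⟶ Y,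
        (ψ.toHom : 𝟙_ GaussEx.{u} ⟶ X ⊗ Y) =
          (ψ.push (LinearMap.fst ℝ X Y)).toHom ≫ Δ[X] ≫ X ◁ k := by
  refine ⟨hasConditionals_gaussEx, fun X Y ψ => ?_⟩
  obtain ⟨s, hs⟩ := GaussianDist.push_mkQ_surjective ψ.locus ψ.dist
  obtain ⟨h, hD, hd⟩ := GaussianDist.exists_disintegration ψ.locus s
  have h₁ : (ψ.toHom : 𝟙_ GaussEx.{u} ⟶ X ⊗ Y) =
      LinRel.rep (X := 𝟙_ GaussEx.{u}) (Y := X ⊗ Y) 0 s ψ.locus :=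
    LinRel.Hom.mk_congr (X := 𝟙_ GaussEx.{u}) (Y := X ⊗ Y) (LinearMap.comp_zero _).symm hs.symm
  have h₂ : ((ψ.push (LinearMap.fst ℝ X Y)).toHom : 𝟙_ GaussEx.{u} ⟶ X) =
      LinRel.rep (X := 𝟙_ GaussEx.{u}) (Y := X) 0 (GaussianDist.push (LinearMap.fst ℝ X Y) s)
        (ψ.locus.map (LinearMap.fst ℝ X Y)) := by
    refine LinRel.Hom.mk_congr (X := 𝟙_ GaussEx.{u}) (Y := X) (LinearMap.comp_zero _).symm ?_
    exact (congrArg (GaussianDist.push _) hs).symm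
  refine ⟨LinRel.rep h
    (GaussianDist.push (LinearMap.snd ℝ X Y - h ∘ₗ LinearMap.fst ℝ X Y) s)
    (ψ.locus.comap (LinearMap.inr ℝ X Y)), ?_⟩
  refine h₁.trans (Eq.trans ?_ (congrArg₂ (· ≫ ·) h₂
    (LinRel.copy_comp_whiskerLeft_rep _ _ _)).symm)
  refine Eq.trans ?_ (LinRel.rep_comp_rep _ _ _ _ _ _).symm
  exact (LinRel.rep_congr_mkQ (Submodule.map_inr_comap_inr_sup_map_selection hD)
    (LinearMap.comp_zero _) hd).symm
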